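/- Let $\ell \ge 1$ be an integer. A decision stump on $\ell$ real-valued features is a binary classifier $h : \mathbb{R}^\ell \to \{0,1\}$ determined by a feature $i \in \{1,\dots,\ell\}$, a threshold $\theta \in \mathbb{R}$, a sign $s \in \{\pm 1\}$ and two labels $a, b \in \{0,1\}$ (possibly equal): $h(x) = a$ if $\operatorname{sign}(x^i - \theta) = s$, and $h(x) = b$ otherwise, where $\operatorname{sign}(u) = +1$ if $u > 0$ and $\operatorname{sign}(u) = -1$ otherwise. Let $T$ be the class of all decision stumps on $\ell$ real-valued features. A finite set $S \subseteq \mathbb{R}^\ell$ is shattered by $T$ if every function $S \to \{0,1\}$ is the restriction to $S$ of some $h \in T$, and the VC dimension of $T$ is the maximal cardinality of a set shattered by $T$. Then the VC dimension of $T$ is exactly the largest integer $d \ge 0$ that satisfies $$2\ell \;\ge\; \binom{d}{\lfloor d/2 \rfloor}$$ (in particular, such a largest integer exists). -/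

import Mathlib

/-- Binary decision trees on examples `x : Fin ℓ → ℝ` (`ℓ` real-valued features) with class labels
in `Y`. A leaf carries a label; a node carries a decision rule, given by a feature `i`, a threshold
`θ` and a sign `s = ±1`, together with a left and a right subtree. -/
inductive DecisionTree (ℓ : ℕ) (Y : Type) : Type
  | leaf (y : Y) : DecisionTree ℓ Y
  | node (i : Fin ℓ) (θ : ℝ) (s : ℤˣ) (left right : DecisionTree ℓ Y) : DecisionTree ℓ Y

/-- The sign of a real number, with values in `{1, -1}` and with the convention that `0` has
sign `-1`. -/
noncomputable def strictSign (u : ℝ) : ℤˣ := if 0 < u then 1 else -1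

/-- The output of a decision tree on an example. -/
noncomputable def DecisionTree.output {ℓ : ℕ} {Y : Type} :
    DecisionTree ℓ Y → (Fin ℓ → ℝ) → Y
  | .leaf y, _ => y
  | .node i θ s left right, x =>
      if strictSign (x i - θ) = s then left.output x else right.output x

/-- A decision stump is a decision tree with exactly one node and two leaves. -/
def DecisionTree.IsStump {ℓ : ℕ} {Y : Type} (t : DecisionTree ℓ Y) : Prop :=
  ∃ (i : Fin ℓ) (θ : ℝ) (s : ℤˣ) (a b : Y), t = .node i θ s (.leaf a) (.leaf b)

/-- The hypothesis class of (binary classification) decision stumps on `ℓ` real-valued features: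
all functions computed by a stump, where the rule of the node and both labels are free. -/
def stumpClass (ℓ : ℕ) : Set ((Fin ℓ → ℝ) → Bool) :=
  {h | ∃ t : DecisionTree ℓ Bool, t.IsStump ∧ t.output = h}

/-- A class `H` of binary classifiers shatters a finite sample `S` if every Boolean function on `S`
is the restriction to `S` of some `h ∈ H`. -/
def ClassShatters {X : Type} (H : Set (X → Bool)) (S : Finset X) : Prop :=
  ∀ g : S → Bool, ∃ h ∈ H, ∀ x : S, h x = g x

/-- The VC dimension of a nonempty class of binary classifiers: the maximal cardinality of a
finite set that it shatters (`⊤` if these cardinalities are unbounded). -/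
noncomputable def classVCDim {X : Type} (H : Set (X → Bool)) : ℕ∞ :=
  ⨆ (S : Finset X) (_ : ClassShatters H S), (S.card : ℕ∞)

/-!
Let `d` be the size of a sample and `k = ⌊d / 2⌋`. For a fixed feature `i`, the subsets
`{x ∈ S | θ < x i}` of a sample `S` form a chain as `θ` varies, and so do their complements; a stump
cuts out a member of one of these `2ℓ` chains, or a trivial subset. A chain contains at most one set
of size `k`, so a shattered set satisfies `d.choose k ≤ 2ℓ` (`choose_le_of_classShatters`).

Conversely, every chain of subsets of a `d`-element set consists of the superlevel sets of a single
real function (`exists_superlevel_of_isChain`), so it suffices to find `ℓ` chains that contain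
every subset or its complement (`exists_isChain_cover`). This needs two ingredients.

* The sets of size at most `k` can be partitioned into chains, one below each `k`-set
  (`exists_top`), by Hall's theorem and the local LYM inequality. If the `k`-sets `A` and `B` are
  disjoint, then the chain below `A` followed by the complements of the chain below `B` is again a
  chain, so one feature takes care of two `k`-sets.
* The `k`-sets can be matched up into disjoint pairs, with at most one left over
  (`exists_involution_disjoint`). For even `d` the complement does this. For `d = 2k + 1` this is a
  near-perfect matching of the odd graph, whose vertices are the `k`-sets and whose edges join
  disjoint sets. It is connected and vertex-transitive, and every such finite graph has a
  near-perfect matching (`exists_isPairing_of_vertexTransitive`). Indeed, if a maximum matching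
  misses some vertex, then by symmetry every vertex is missed by some maximum matching, and Gallai's
  lemma (`IsMaxPairing.eq_of_transitive`) makes "no maximum matching misses both `u` and `v`"
  a transitive relation. It holds for adjacent `u` and `v`, hence for all `u` and `v`.
-/

/-! ### Maximum matchings in vertex-transitive graphs -/

section Pairing

open Finset Equiv

variable {V : Type*} {G : SimpleGraph V} {m n : Perm V}

/-- A matching of `G`, encoded as the involution that swaps the two ends of every matching edge and
fixes the unmatched vertices. -/
structure IsPairing (G : SimpleGraph V) (m : Perm V) : Prop where
  apply_apply : ∀ v, m (m v) = v
  eq_or_adj : ∀ v, m v = v ∨ G.Adj v (m v)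

theorem isPairing_one : IsPairing G 1 := ⟨fun _ => rfl, fun _ => Or.inl rfl⟩

/-- Two adjacent unmatched vertices can be matched with each other. -/
theorem IsPairing.mul_swap [DecidableEq V] (hm : IsPairing G m) {x y : V} (hxy : G.Adj x y)
    (hx : m x = x) (hy : m y = y) : IsPairing G (m * swap x y) := by
  have key : ∀ v, v ≠ x → v ≠ y → m v ≠ x ∧ m v ≠ y := fun v h1 h2 =>
    ⟨fun h => h1 (m.injective (h.trans hx.symm)), fun h => h2 (m.injective (h.trans hy.symm))⟩
  refine ⟨fun v => ?_, fun v => ?_⟩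
  · by_cases h1 : v = x
    · subst h1; simp [hx, hy]
    by_cases h2 : v = y
    · subst h2; simp [hx, hy]
    simp [swap_apply_of_ne_of_ne h1 h2, swap_apply_of_ne_of_ne (key v h1 h2).1 (key v h1 h2).2,
      hm.apply_apply]
  · by_cases h1 : v = x
    · subst h1; right; simpa [hy] using hxy
    by_cases h2 : v = y
    · subst h2; right; simpa [hx] using hxy.symm
    simpa [swap_apply_of_ne_of_ne h1 h2] using hm.eq_or_adj v

/-- If `x` is unmatched, `y` is matched with `z` and `xy` is an edge, then `xy` can take the place of
`yz`. On involutions this is conjugation by the transposition of `x` and `z`. -/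
theorem IsPairing.swap_conj [DecidableEq V] (hm : IsPairing G m) {x y z : V} (hxy : G.Adj x y)
    (hx : m x = x) (hyz : m y = z) (hzy : z ≠ y) : IsPairing G (swap x z * m * swap x z) := by
  have hzx : z ≠ x := fun h => hxy.ne (m.injective (by rw [hx, hyz, h]))
  have hz : m z = y := by rw [← hyz, hm.apply_apply]
  refine ⟨fun v => by simp [hm.apply_apply], fun v => ?_⟩
  by_cases h1 : v = x
  · subst h1
    right
    simpa [hz, swap_apply_of_ne_of_ne hxy.ne.symm hzy.symm] using hxy
  by_cases h2 : v = z
  · subst h2; left; simp [hx]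
  by_cases h3 : v = y
  · subst h3
    right
    simpa [swap_apply_of_ne_of_ne h1 h2, hyz] using hxy.symm
  have h4 : m v ≠ x := fun h => h1 (m.injective (h.trans hx.symm))
  have h5 : m v ≠ z := fun h => h3 (m.injective (h.trans hyz.symm))
  simpa [swap_apply_of_ne_of_ne h1 h2, swap_apply_of_ne_of_ne h4 h5] using hm.eq_or_adj v

theorem conj_iso_apply (m : Perm V) (φ : G ≃g G) (w : V) :
    (φ.toEquiv * m * φ.toEquiv⁻¹) (φ w) = φ (m w) :=
  congrArg (fun x => φ (m x)) (φ.toEquiv.symm_apply_apply w)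

variable [Fintype V] [DecidableEq V]

/-- A matching with as few unmatched vertices as possible. -/
structure IsMaxPairing (G : SimpleGraph V) (m : Perm V) : Prop extends IsPairing G m where
  card_le : ∀ n, IsPairing G n → #{v | m v = v} ≤ #{v | n v = v}

theorem exists_isMaxPairing (G : SimpleGraph V) : ∃ m, IsMaxPairing G m := by
  obtain ⟨m, hm, h⟩ := Set.exists_min_image {m | IsPairing G m} (fun m => #{v | m v = v})
    (Set.toFinite _) ⟨1, isPairing_one⟩
  exact ⟨m, hm, h⟩

/-- A maximum matching leaves no two adjacent vertices unmatched. -/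
theorem IsMaxPairing.not_adj (hm : IsMaxPairing G m) {x y : V} (hx : m x = x) (hy : m y = y) :
    ¬ G.Adj x y := by
  intro hxy
  refine absurd (hm.card_le _ (hm.toIsPairing.mul_swap hxy hx hy)) (not_le.2 ?_)
  refine card_lt_card ⟨fun v => ?_, fun h => ?_⟩
  · simp only [mem_filter, mem_univ, true_and]
    intro hv
    by_cases h1 : v = x
    · rw [h1, hx]
    by_cases h2 : v = y
    · rw [h2, hy]
    simpa [swap_apply_of_ne_of_ne h1 h2] using hv
  · have hx' : x ∈ ({v | m v = v} : Finset V) := by simpa using hx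
    have := (mem_filter.1 (h hx')).2
    simp [hy, hxy.ne.symm] at this

theorem IsMaxPairing.card_eq (hm : IsMaxPairing G m) (hn : IsMaxPairing G n) :
    #{v | m v = v} = #{v | n v = v} :=
  le_antisymm (hm.card_le _ hn.toIsPairing) (hn.card_le _ hm.toIsPairing)

theorem card_fixed_conj (m φ : Perm V) :
    #{v | (φ * m * φ⁻¹) v = v} = #{v | m v = v} := by
  refine (card_bij (fun v _ => φ v) (fun v hv => ?_) (fun _ _ _ _ h => φ.injective h)
    (fun v hv => ⟨φ⁻¹ v, ?_, by simp⟩)).symm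
  · rw [mem_filter] at hv ⊢
    simpa using hv.2
  · rw [mem_filter] at hv ⊢
    exact ⟨mem_univ _, φ.injective (by simpa using hv.2)⟩

theorem IsMaxPairing.conj_iso (hm : IsMaxPairing G m) (φ : G ≃g G) :
    IsMaxPairing G (φ.toEquiv * m * φ.toEquiv⁻¹) where
  apply_apply v := by
    obtain ⟨w, rfl⟩ := φ.surjective v
    rw [conj_iso_apply, conj_iso_apply, hm.apply_apply]
  eq_or_adj v := by
    obtain ⟨w, rfl⟩ := φ.surjective v
    rw [conj_iso_apply]
    exact (hm.eq_or_adj w).imp (congrArg φ) φ.map_adj_iff.2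
  card_le n hn := by rw [card_fixed_conj]; exact hm.card_le n hn

/-- **Gallai's lemma**, in the form of a transitivity statement. If no maximum matching misses both
`u` and `t`, none misses both `t` and `v`, and some maximum matching misses `t`, then no maximum
matching misses both `u` and `v`. -/
theorem IsMaxPairing.eq_of_transitive {u t v : V} (ht : ∃ n, IsMaxPairing G n ∧ n t = t)
    (hut : ∀ n, IsMaxPairing G n → n u = u → n t = t → u = t)
    (htv : ∀ n, IsMaxPairing G n → n t = t → n v = v → t = v)
    (hm : IsMaxPairing G m) (hu : m u = u) (hv : m v = v) : u = v := by
  by_contra huv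
  -- Among the maximum matchings that miss `t`, take one that agrees with `m` as much as possible.
  obtain ⟨n, ⟨hn, hnt⟩, hmax⟩ := Set.exists_max_image {n | IsMaxPairing G n ∧ n t = t}
    (fun n => #{w | n w = m w}) (Set.toFinite _) ht
  have hmt : m t ≠ t := fun h => huv ((hut m hm hu h).trans (htv m hm h hv))
  have hnu : n u ≠ u := fun h => hmt (hut n hn h hnt ▸ hu)
  have hnv : n v ≠ v := fun h => hmt ((htv n hn hnt h).symm ▸ hv)
  -- The matching `m` misses `u` and `v`, which `n` covers, so `n` misses two vertices that `m`
  -- covers; one of them is not `t`.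
  obtain ⟨x, hx, hxt⟩ : ∃ x ∈ ({w | n w = w} : Finset V) \ ({w | m w = w} : Finset V), x ≠ t := by
    refine exists_mem_ne ?_ t
    rw [card_sdiff_comm (hn.card_eq hm)]
    refine one_lt_card.2 ⟨u, ?_, v, ?_, huv⟩ <;> simp [*]
  simp only [mem_sdiff, mem_filter, mem_univ, true_and] at hx
  obtain ⟨hnx, hmx⟩ := hx
  have hxy : G.Adj x (m x) := (hm.eq_or_adj x).resolve_left hmx
  have hny : n (m x) ≠ m x := fun h => hn.not_adj hnx h hxy
  generalize hy : m x = y at *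
  have hmy : m y = x := by rw [← hy, hm.apply_apply]
  have hnny := hn.apply_apply y
  have hzx : n y ≠ x := fun h => hxy.ne (by rw [← hnny, h, hnx])
  have hzt : t ≠ n y := fun h => hny (by rw [h, hnny] at hnt; exact hnt.symm)
  -- Replacing the edge `n y — y` of `n` by the edge `x — y` of `m` increases the agreement.
  have hn' := hn.swap_conj hxy hnx rfl hny
  refine absurd (hmax (swap x (n y) * n * swap x (n y)) ⟨⟨hn', fun p hp => ?_⟩, ?_⟩) (not_le.2 ?_)
  · have := card_fixed_conj n (swap x (n y))
    rw [swap_inv] at this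
    rw [this]
    exact hn.card_le p hp
  · simp [swap_apply_of_ne_of_ne hxt.symm hzt, hnt]
  · refine card_lt_card ⟨fun w => ?_, fun h => ?_⟩
    · simp only [mem_filter, mem_univ, true_and]
      intro hw
      have h1 : w ≠ x := fun h => hmx (by rw [← hy, ← h, ← hw, h, hnx])
      have h2 : w ≠ n y := fun h => hzx (by
        rw [h, hnny] at hw
        have := congrArg m hw
        rw [hm.apply_apply, hmy] at this
        exact this.symm)
      have h3 : w ≠ y := fun h => hzx (by rw [← h, hw, h, hmy])
      have h4 : n w ≠ x := fun h => h1 (n.injective (h.trans hnx.symm))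
      have h5 : n w ≠ n y := fun h => h3 (n.injective h)
      simpa [swap_apply_of_ne_of_ne h1 h2, swap_apply_of_ne_of_ne h4 h5] using hw
    · have hx' : x ∈ ({w | (swap x (n y) * n * swap x (n y)) w = m w} : Finset V) := by
        rw [mem_filter]
        simp [hnny, hy, swap_apply_of_ne_of_ne hxy.ne.symm hny.symm]
      have := (mem_filter.1 (h hx')).2
      exact hmx (by rw [← hy, ← this, hnx])

/-- A connected vertex-transitive finite graph has a matching that misses at most one vertex. -/
theorem exists_isPairing_of_vertexTransitive (hG : G.Preconnected)
    (htrans : ∀ u v : V, ∃ φ : G ≃g G, φ u = v) :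
    ∃ m, IsPairing G m ∧ ∀ u v, m u = u → m v = v → u = v := by
  obtain ⟨m, hm⟩ := exists_isMaxPairing G
  refine ⟨m, hm.toIsPairing, fun u v hu hv => ?_⟩
  -- By transitivity, every vertex is missed by some maximum matching.
  have hmiss : ∀ w, ∃ n, IsMaxPairing G n ∧ n w = w := fun w => by
    obtain ⟨φ, rfl⟩ := htrans u w
    exact ⟨_, hm.conj_iso φ, by rw [conj_iso_apply, hu]⟩
  have key : ∀ w, G.Reachable u w → ∀ n, IsMaxPairing G n → n u = u → n w = w → u = w := by
    intro w hw
    rw [SimpleGraph.reachable_iff_reflTransGen] at hw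
    induction hw with
    | refl => exact fun _ _ _ _ => rfl
    | tail _ hab ih =>
      exact fun n hn hnu hnb => IsMaxPairing.eq_of_transitive (hmiss _) ih
        (fun p hp h1 h2 => absurd hab (hp.not_adj h1 h2)) hn hnu hnb
  exact key v (hG u v) m hm hu hv

end Pairing

/-! ### The odd graph -/

section OddGraph

open Finset

variable {α : Type*}

/-- The graph on the `k`-subsets of `α` in which two distinct sets are adjacent when they are
disjoint (the Kneser graph). -/
def kneserGraph (α : Type*) (k : ℕ) : SimpleGraph {s : Finset α // #s = k} where
  Adj s t := s ≠ t ∧ Disjoint s.1 t.1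
  symm := ⟨fun _ _ h => ⟨h.1.symm, h.2.symm⟩⟩
  loopless := ⟨fun _ h => h.1 rfl⟩

/-- A permutation of the ground set acts on the Kneser graph. -/
def kneserIso (k : ℕ) (e : Equiv.Perm α) : kneserGraph α k ≃g kneserGraph α k where
  toEquiv := (Equiv.finsetCongr e).subtypeEquiv (fun s => by simp)
  map_rel_iff' {s t} := by
    simp [kneserGraph, Subtype.ext_iff]

theorem exists_kneserIso_apply_eq [Finite α] {k : ℕ} (s t : {s : Finset α // #s = k}) :
    ∃ φ : kneserGraph α k ≃g kneserGraph α k, φ s = t := by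
  classical
  let e : {x // x ∈ s.1} ≃ {x // x ∈ t.1} := Finset.equivOfCardEq (s.2.trans t.2.symm)
  refine ⟨kneserIso k e.extendSubtype, Subtype.ext (eq_of_subset_of_card_le ?_ ?_)⟩
  · intro x hx
    obtain ⟨y, hy, rfl⟩ := mem_map.1 (show x ∈ s.1.map _ from hx)
    exact e.extendSubtype_mem y hy
  · rw [(kneserIso k e.extendSubtype s).2, t.2]

variable [Fintype α] [DecidableEq α]

/-- Exchanging one element of a `k`-subset of a set with `2k + 1` elements is a walk of length two
in the odd graph. -/
theorem kneserGraph_reachable_exchange {k : ℕ} (hα : Fintype.card α = 2 * k + 1)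
    (s t : {s : Finset α // #s = k}) {a b : α} (ha : a ∈ s.1) (hb : b ∉ s.1)
    (ht : t.1 = insert b (s.1.erase a)) : (kneserGraph α k).Reachable s t := by
  have hk : 0 < k := s.2 ▸ card_pos.2 ⟨a, ha⟩
  let u : {s : Finset α // #s = k} := ⟨(insert b s.1)ᶜ, by
    rw [card_compl, card_insert_of_notMem hb, s.2, hα]; omega⟩
  have adj : ∀ v : {s : Finset α // #s = k}, Disjoint v.1 u.1 → (kneserGraph α k).Adj v u :=
    fun v hv => ⟨fun h => by
      rw [h, disjoint_self_iff_empty] at hv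
      have := u.2
      rw [hv, card_empty] at this
      omega, hv⟩
  refine (adj s ?_).reachable.trans (adj t ?_).symm.reachable
  · exact disjoint_compl_right.mono_left (subset_insert b s.1)
  · rw [ht]
    exact disjoint_compl_right.mono_left (insert_subset_insert _ (erase_subset _ _))

theorem kneserGraph_preconnected {k : ℕ} (hα : Fintype.card α = 2 * k + 1) :
    (kneserGraph α k).Preconnected := by
  intro s t
  induction h : #(s.1 \ t.1) generalizing s with
  | zero =>
    have : s = t := Subtype.ext (eq_of_subset_of_card_le
      (sdiff_eq_empty_iff_subset.1 (card_eq_zero.1 h)) (by rw [s.2, t.2]))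
    exact this ▸ SimpleGraph.Reachable.refl s
  | succ n ih =>
    obtain ⟨a, ha⟩ := card_pos.1 (show 0 < #(s.1 \ t.1) by omega)
    obtain ⟨b, hb⟩ := card_pos.1
      (show 0 < #(t.1 \ s.1) by rw [card_sdiff_comm (t.2.trans s.2.symm)]; omega)
    have ha' := ha
    rw [mem_sdiff] at ha hb
    let s' : {s : Finset α // #s = k} := ⟨insert b (s.1.erase a), by
      have := card_pos.2 ⟨a, ha.1⟩
      rw [card_insert_of_notMem (fun h => hb.2 (mem_of_mem_erase h)), card_erase_of_mem ha.1]
      have := s.2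
      omega⟩
    refine (kneserGraph_reachable_exchange hα s s' ha.1 hb.2 rfl).trans (ih s' ?_)
    have : s'.1 \ t.1 = (s.1 \ t.1).erase a := by
      rw [insert_sdiff_of_mem _ hb.1, erase_sdiff_comm]
    rw [this, card_erase_of_mem ha', h, Nat.add_sub_cancel]

/-- The subsets of size `⌊d / 2⌋` of a `d`-element set can be matched up into disjoint pairs, with at
most one set left over. -/
theorem exists_involution_disjoint :
    ∃ m : Equiv.Perm {s : Finset α // #s = Fintype.card α / 2}, (∀ s, m (m s) = s) ∧
      (∀ s, m s = s ∨ Disjoint s.1 (m s).1) ∧ ∀ s t, m s = s → m t = t → s = t := by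
  rcases Nat.even_or_odd' (Fintype.card α) with ⟨k, hk | hk⟩
  · -- For even `d` the complement is a perfect matching.
    have hcompl : ∀ s : Finset α, #s = Fintype.card α / 2 → #sᶜ = Fintype.card α / 2 :=
      fun s hs => by rw [card_compl]; omega
    have hinv : Function.Involutive
        (fun s : {s : Finset α // #s = Fintype.card α / 2} => ⟨s.1ᶜ, hcompl _ s.2⟩) :=
      fun s => Subtype.ext (compl_compl s.1)
    refine ⟨hinv.toPerm, hinv, fun s => Or.inr disjoint_compl_right, fun s t hs _ => ?_⟩
    have h0 : s.1 = ∅ := by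
      rw [← disjoint_self_iff_empty]
      nth_rw 2 [← congrArg Subtype.val hs]
      exact disjoint_compl_right
    have := s.2
    rw [h0, card_empty] at this
    exact Subtype.ext (h0.trans (card_eq_zero.1 (t.2.trans this.symm)).symm)
  · have h : Fintype.card α / 2 = k := by omega
    rw [h]
    obtain ⟨m, hm, hfix⟩ := exists_isPairing_of_vertexTransitive
      (kneserGraph_preconnected hk) exists_kneserIso_apply_eq
    exact ⟨m, hm.apply_apply, fun s => (hm.eq_or_adj s).imp_right And.right, hfix⟩

end OddGraph

/-! ### Covering the Boolean lattice by chains -/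

section ChainCover

open Finset
open scoped FinsetFamily

variable {α : Type*} [Fintype α] [DecidableEq α]

/-- Below the middle of the Boolean lattice, each level can be matched into the next one: Hall's
condition is the local LYM inequality for upper shadows. -/
theorem exists_injective_superset {j : ℕ} (hj : 2 * j + 1 ≤ Fintype.card α) :
    ∃ f : {s : Finset α // #s = j} → Finset α, Function.Injective f ∧
      ∀ s, s.1 ⊆ f s ∧ #(f s) = j + 1 := by
  have hall : ∀ 𝒜 : Finset {s : Finset α // #s = j}, #𝒜 ≤ #(𝒜.biUnion fun s => ∂⁺ {s.1}) := by
    intro 𝒜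
    set ℬ : Finset (Finset α) := 𝒜.map (Function.Embedding.subtype _) with hℬ
    have hsized : (ℬᶜˢ : Set (Finset α)).Sized (Fintype.card α - j) := by
      intro s hs
      obtain ⟨t, -, ht⟩ := mem_map.1 (mem_compls.1 (mem_coe.1 hs))
      have := (congrArg card ht).symm.trans t.2
      have h2 := card_compl s
      have h3 := s.card_le_univ
      omega
    have hlym := card_mul_le_card_shadow_mul hsized
    rw [shadow_compls, card_compls, card_compls, show
      Fintype.card α - (Fintype.card α - j) + 1 = j + 1 by omega] at hlym
    have hshadow : 𝒜.biUnion (fun s => ∂⁺ {s.1}) = ∂⁺ ℬ := by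
      ext t
      simp [mem_upShadow_iff, hℬ]
    rw [hshadow, ← card_map (Function.Embedding.subtype _), ← hℬ]
    have h1 : #ℬ * (j + 1) ≤ #(∂⁺ ℬ) * (j + 1) :=
      (Nat.mul_le_mul_left _ (by omega)).trans hlym
    exact Nat.le_of_mul_le_mul_right h1 j.succ_pos
  obtain ⟨f, hf, hsup⟩ := (Finset.all_card_le_biUnion_card_iff_exists_injective _).1 hall
  refine ⟨f, hf, fun s => ?_⟩
  obtain ⟨t, ht, a, ha, h⟩ := mem_upShadow_iff.1 (hsup s)
  rw [mem_singleton] at ht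
  rw [← h, card_insert_of_notMem ha, ht, s.2]
  exact ⟨subset_insert _ _, rfl⟩

/-- The sets in the lower half of the Boolean lattice can be partitioned into chains that all end
in the middle level; `top s` is the end of the chain through `s`. -/
theorem exists_top (α : Type*) [Fintype α] [DecidableEq α] :
    ∃ top : Finset α → Finset α,
      (∀ s, #s ≤ Fintype.card α / 2 → s ⊆ top s ∧ #(top s) = Fintype.card α / 2) ∧
      ∀ s t, #s ≤ #t → #t ≤ Fintype.card α / 2 → top s = top t → s ⊆ t := by
  set k := Fintype.card α / 2 with hk
  have hstep : ∀ j, ∃ f : Finset α → Finset α, j < k →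
      Set.InjOn f {s | #s = j} ∧ ∀ s, #s = j → s ⊆ f s ∧ #(f s) = j + 1 := by
    intro j
    by_cases hj : j < k
    · obtain ⟨f, hf, h⟩ := exists_injective_superset (α := α) (j := j) (by omega)
      refine ⟨fun s => if hs : #s = j then f ⟨s, hs⟩ else ∅, fun _ => ⟨fun s hs t ht h => ?_,
        fun s hs => ?_⟩⟩
      · rw [Set.mem_ofPred_eq] at hs ht
        simpa [hs, ht, hf.eq_iff] using h
      · simpa [hs] using h ⟨s, hs⟩
    · exact ⟨id, fun h => absurd h hj⟩
  choose f hf using hstep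
  -- `up n s` goes `n` steps up from `s`.
  let step : Finset α → Finset α := fun s => f #s s
  have hup : ∀ n s, #s + n ≤ k → s ⊆ step^[n] s ∧ #(step^[n] s) = #s + n := by
    intro n
    induction n with
    | zero => intro s _; simp
    | succ n ih =>
      intro s hs
      have h1 := (hf #s (by omega)).2 s rfl
      have h2 := ih (step s) (by rw [h1.2]; omega)
      rw [Function.iterate_succ_apply]
      exact ⟨h1.1.trans h2.1, by rw [h2.2, h1.2]; omega⟩
  have hinj : ∀ n s t, #s = #t → #s + n ≤ k → step^[n] s = step^[n] t → s = t := by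
    intro n
    induction n with
    | zero => intro s t _ _ h; exact h
    | succ n ih =>
      intro s t hst hs h
      have h1 := (hf #s (by omega)).2 s rfl
      have h2 := (hf #t (by omega)).2 t rfl
      have h3 : step s = step t := ih _ _ (by rw [h1.2, h2.2, hst]) (by rw [h1.2]; omega) h
      exact (hf #s (by omega)).1 rfl hst.symm (h3.trans (by simp only [step, hst]))
  refine ⟨fun s => step^[k - #s] s, fun s hs => ?_, fun s t hst ht h => ?_⟩
  · have := hup (k - #s) s (by omega)
    exact ⟨this.1, by rw [this.2]; omega⟩
  · have h1 := hup (#t - #s) s (by omega)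
    have h2 : step^[#t - #s] s = t := by
      refine hinj (k - #t) _ _ (by rw [h1.2]; omega) (by rw [h1.2]; omega) ?_
      rw [← Function.iterate_add_apply, show k - #t + (#t - #s) = k - #s by omega]
      exact h
    exact h2 ▸ h1.1

/-- If an involution has at most one fixed point, then about half of all points suffice to meet
each of its orbits. -/
theorem exists_orbit_representatives {V : Type*} [Fintype V] [Nonempty V] {m : Equiv.Perm V}
    (hm : ∀ v, m (m v) = v) (hfix : ∀ u v, m u = u → m v = v → u = v) {ℓ : ℕ}
    (hℓ : Fintype.card V ≤ 2 * ℓ) : ∃ rep : Fin ℓ → V, ∀ v, ∃ i, rep i = v ∨ rep i = m v := by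
  classical
  let e := Fintype.equivFin V
  -- From each orbit take the point that comes first in some enumeration.
  let T : Finset V := {v | e v ≤ e (m v)}
  have hT : #T ≤ ℓ := by
    have h1 : #T + #{v | ¬ e v ≤ e (m v)} = Fintype.card V :=
      card_filter_add_card_filter_not _
    have h2 : #{v | e v < e (m v)} ≤ #{v | ¬ e v ≤ e (m v)} :=
      card_le_card_of_injOn m (fun v hv => by
        simp only [coe_filter, mem_univ, true_and, Set.mem_ofPred_eq] at hv ⊢
        rw [hm]; exact not_le.2 hv) m.injective.injOn
    have h3 : #{v | m v = v} ≤ 1 := card_le_one.2 fun u hu v hv =>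
      hfix u v (mem_filter.1 hu).2 (mem_filter.1 hv).2
    have h4 : T ⊆ ({v | e v < e (m v)} : Finset V) ∪ ({v | m v = v} : Finset V) := by
      intro v hv
      rcases (mem_filter.1 hv).2.lt_or_eq with h | h
      · exact mem_union_left _ (by simpa using h)
      · exact mem_union_right _ (by simpa using (e.injective h).symm)
    have h5 := (card_le_card h4).trans (card_union_le _ _)
    omega
  obtain ⟨g⟩ : Nonempty (T ↪ Fin ℓ) :=
    Function.Embedding.nonempty_of_card_le (by simpa using hT)
  refine ⟨Function.extend g Subtype.val (fun _ => Classical.arbitrary V), fun v => ?_⟩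
  rcases le_total (e v) (e (m v)) with h | h
  · exact ⟨g ⟨v, by simpa [T] using h⟩, Or.inl (g.injective.extend_apply _ _ _)⟩
  · exact ⟨g ⟨m v, by simpa [T, hm] using h⟩, Or.inr (g.injective.extend_apply _ _ _)⟩

/-- If `2ℓ` is at least the middle binomial coefficient, then `ℓ` chains of subsets suffice to
contain every subset or its complement. Each chain is made of the chain below a middle set `A` and
of the complements of the chain below a middle set disjoint from `A`. -/
theorem exists_isChain_cover {ℓ : ℕ}
    (hℓ : (Fintype.card α).choose (Fintype.card α / 2) ≤ 2 * ℓ) :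
    ∃ C : Fin ℓ → Finset (Finset α), (∀ i, IsChain (· ⊆ ·) (C i : Set (Finset α))) ∧
      ∀ U, ∃ i, U ∈ C i ∨ Uᶜ ∈ C i := by
  obtain ⟨top, htop, hchain⟩ := exists_top α
  obtain ⟨m, hm, hdisj, hfix⟩ := exists_involution_disjoint (α := α)
  have hne : Nonempty {s : Finset α // #s = Fintype.card α / 2} :=
    ⟨⟨top ∅, (htop ∅ (by simp)).2⟩⟩
  obtain ⟨rep, hrep⟩ := exists_orbit_representatives hm hfix (ℓ := ℓ) (by
    rwa [Fintype.card_finset_len])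
  have hcomp : ∀ s t, #s ≤ Fintype.card α / 2 → #t ≤ Fintype.card α / 2 → top s = top t →
      s ⊆ t ∨ t ⊆ s := fun s t hs ht h => (le_total #s #t).imp
    (fun hst => hchain s t hst ht h) (fun hts => hchain t s hts hs h.symm)
  let C : Fin ℓ → Finset (Finset α) := fun i =>
    {U | (#U ≤ Fintype.card α / 2 ∧ top U = rep i) ∨
      (#Uᶜ ≤ Fintype.card α / 2 ∧ top Uᶜ = m (rep i) ∧ Disjoint (rep i).1 (m (rep i)).1)}
  -- `U` lies below `rep i` and `Wᶜ` below the disjoint set `m (rep i)`, so `U` misses `Wᶜ`.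
  have hcross : ∀ i U W, #U ≤ Fintype.card α / 2 → top U = rep i → #Wᶜ ≤ Fintype.card α / 2 →
      top Wᶜ = m (rep i) → Disjoint (rep i).1 (m (rep i)).1 → U ⊆ W := by
    intro i U W hU hUt hW hWt hd
    have h1 := (htop U hU).1
    have h2 := (htop _ hW).1
    rw [hUt] at h1
    rw [hWt] at h2
    exact disjoint_compl_right_iff.1 (hd.mono h1 h2)
  -- A set of size at most `⌊d / 2⌋` is covered through the middle set above it, and a larger set
  -- through its complement.
  have hlow : ∀ U, #U ≤ Fintype.card α / 2 → ∃ i, U ∈ C i ∨ Uᶜ ∈ C i := by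
    intro U hU
    obtain ⟨i, hi⟩ := hrep ⟨top U, (htop U hU).2⟩
    refine ⟨i, ?_⟩
    rcases hi with h | h
    · left
      simp [C, h, hU]
    · have h' : m (rep i) = ⟨top U, (htop U hU).2⟩ := by rw [h, hm]
      rcases hdisj (rep i) with h2 | h2
      · refine Or.inl (mem_filter.2 ⟨mem_univ _, Or.inl ⟨hU, ?_⟩⟩)
        rw [← h2, h']
      · right
        rw [h'] at h2
        simp [C, h', hU, h2]
  refine ⟨C, fun i U hU W hW _ => ?_, fun U => ?_⟩
  · simp only [C, coe_filter, mem_univ, true_and, Set.mem_ofPred_eq] at hU hW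
    rcases hU with ⟨hU, hUt⟩ | ⟨hU, hUt, hd⟩ <;> rcases hW with ⟨hW, hWt⟩ | ⟨hW, hWt, hd'⟩
    · exact hcomp U W hU hW (hUt.trans hWt.symm)
    · exact Or.inl (hcross i U W hU hUt hW hWt hd')
    · exact Or.inr (hcross i W U hW hWt hU hUt hd)
    · exact (hcomp _ _ hW hU (hWt.trans hUt.symm)).imp compl_subset_compl.1 compl_subset_compl.1
  · rcases le_or_gt #U (Fintype.card α / 2) with h | h
    · exact hlow U h
    · obtain ⟨i, hi⟩ := hlow Uᶜ (by rw [card_compl]; omega)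
      exact ⟨i, by simpa [or_comm] using hi⟩

/-- Every chain of subsets consists of superlevel sets of one real function, which counts the
members of the chain that contain a given point. -/
theorem exists_superlevel_of_isChain {α : Type*} [DecidableEq α] {C : Finset (Finset α)}
    (hC : IsChain (· ⊆ ·) (C : Set (Finset α))) :
    ∃ x : α → ℝ, ∀ U ∈ C, ∃ θ, ∀ p, p ∈ U ↔ θ < x p := by
  refine ⟨fun p => #{W ∈ C | p ∈ W}, fun U hU => ⟨#{W ∈ C | U ⊂ W}, fun p => ?_⟩⟩
  rw [Nat.cast_lt]
  constructor
  · intro hp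
    refine card_lt_card ⟨fun W hW => ?_, fun h => ?_⟩
    · rw [mem_filter] at hW ⊢
      exact ⟨hW.1, hW.2.1 hp⟩
    · have hU' : U ∈ ({W ∈ C | p ∈ W} : Finset _) := mem_filter.2 ⟨hU, hp⟩
      exact (mem_filter.1 (h hU')).2.2 Subset.rfl
  · intro h
    by_contra hp
    refine absurd h (not_lt.2 (card_le_card fun W hW => ?_))
    rw [mem_filter] at hW ⊢
    have hWU : ¬ W ⊆ U := fun h => hp (h hW.2)
    exact ⟨hW.1, (hC.total hU hW.1).resolve_right hWU, hWU⟩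

end ChainCover

/-! ### Decision stumps -/

section Stump

open Finset

theorem mem_stumpClass {ℓ : ℕ} {h : (Fin ℓ → ℝ) → Bool} :
    h ∈ stumpClass ℓ ↔ ∃ (i : Fin ℓ) (θ : ℝ) (s : ℤˣ) (a b : Bool),
      ∀ x, h x = if strictSign (x i - θ) = s then a else b := by
  constructor
  · rintro ⟨t, ⟨i, θ, s, a, b, rfl⟩, rfl⟩
    exact ⟨i, θ, s, a, b, fun x => rfl⟩
  · rintro ⟨i, θ, s, a, b, hx⟩
    exact ⟨_, ⟨i, θ, s, a, b, rfl⟩, funext fun x => (hx x).symm⟩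

theorem strictSign_sub_eq_one {u θ : ℝ} : strictSign (u - θ) = 1 ↔ θ < u := by
  unfold strictSign
  split_ifs with h
  · simpa using h
  · simpa using h

/-- A stump is constant, or it is the indicator of an open half-space `θ < x i`, or the indicator of
the complement of such a half-space. -/
theorem stumpClass_cases {ℓ : ℕ} {h : (Fin ℓ → ℝ) → Bool} (hh : h ∈ stumpClass ℓ) :
    (∃ c, ∀ x, h x = c) ∨ ∃ (i : Fin ℓ) (θ : ℝ) (c : Bool), ∀ x, h x = c ↔ θ < x i := by
  obtain ⟨i, θ, s, a, b, hx⟩ := mem_stumpClass.1 hh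
  rcases eq_or_ne a b with rfl | hab
  · exact Or.inl ⟨a, fun x => by simp [hx]⟩
  right
  rcases Int.units_eq_one_or s with rfl | rfl
  · refine ⟨i, θ, a, fun x => ?_⟩
    rw [hx, ← strictSign_sub_eq_one]
    split_ifs with h <;> simp [h, hab.symm]
  · refine ⟨i, θ, b, fun x => ?_⟩
    rw [hx, ← strictSign_sub_eq_one]
    rcases Int.units_eq_one_or (strictSign (x i - θ)) with h | h <;> simp [h, hab]

/-- Both labellings by a half-space `θ < x i` belong to the class of stumps. -/
theorem exists_mem_stumpClass {ℓ : ℕ} (i : Fin ℓ) (θ : ℝ) (c : Bool) :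
    ∃ h ∈ stumpClass ℓ, ∀ x, h x = c ↔ θ < x i := by
  refine ⟨fun x => if strictSign (x i - θ) = 1 then c else !c,
    mem_stumpClass.2 ⟨i, θ, 1, c, !c, fun _ => rfl⟩, fun x => ?_⟩
  rw [← strictSign_sub_eq_one]
  by_cases h : strictSign (x i - θ) = 1 <;> simp [h]

/-- Upper bound: for a fixed feature, the half-spaces cut out a chain of subsets of `S`, and so do
their complements. Each of these `2ℓ` chains contains at most one set of the middle size. -/
theorem choose_le_of_classShatters {ℓ : ℕ} (hℓ : 1 ≤ ℓ) {S : Finset (Fin ℓ → ℝ)}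
    (hS : ClassShatters (stumpClass ℓ) S) : (#S).choose (#S / 2) ≤ 2 * ℓ := by
  classical
  rcases Nat.lt_or_ge #S 2 with hlt | hge
  · have : (#S).choose (#S / 2) = 1 := by interval_cases #S <;> rfl
    omega
  have key : ∀ A ∈ S.powersetCard (#S / 2), ∃ (q : Fin ℓ × Bool) (θ : ℝ),
      ∀ x ∈ S, (decide (x ∈ A) = q.2 ↔ θ < x q.1) := by
    intro A hA
    obtain ⟨hAS, hAc⟩ := mem_powersetCard.1 hA
    obtain ⟨h, hh, hg⟩ := hS fun x => decide (x.1 ∈ A)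
    rcases stumpClass_cases hh with ⟨c, hc⟩ | ⟨i, θ, c, hc⟩
    · -- A constant stump would cut out the empty set or all of `S`.
      exfalso
      obtain ⟨x, hx⟩ := card_pos.1 (show 0 < #A by omega)
      obtain ⟨y, hy, hyA⟩ := exists_mem_notMem_of_card_lt_card (show #A < #S by omega)
      have h1 := hg ⟨x, hAS hx⟩
      have h2 := hg ⟨y, hy⟩
      simp only [hc, hx, hyA, decide_true, decide_false] at h1 h2
      exact absurd (h1.symm.trans h2) (by decide)
    · exact ⟨(i, c), θ, fun x hx => by rw [← hc, hg ⟨x, hx⟩]⟩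
  have : Nonempty (Fin ℓ) := ⟨⟨0, hℓ⟩⟩
  choose! q θ hq using key
  rw [← card_powersetCard]
  calc _ ≤ #(univ : Finset (Fin ℓ × Bool)) := card_le_card_of_injOn q (by simp) ?_
    _ = 2 * ℓ := by simp [mul_comm]
  -- Of two members of a chain one contains the other, hence equal size means equality.
  have hmono : ∀ A ∈ S.powersetCard (#S / 2), ∀ B ∈ S.powersetCard (#S / 2), q A = q B →
      θ A ≤ θ B → A = B := by
    intro A hA B hB hAB hθ
    have hA' := mem_powersetCard.1 hA
    have hB' := mem_powersetCard.1 hB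
    have himp : ∀ x ∈ S, decide (x ∈ B) = (q A).2 → decide (x ∈ A) = (q A).2 := by
      intro x hx h
      rw [hq A hA x hx]
      rw [hAB, hq B hB x hx, ← hAB] at h
      exact hθ.trans_lt h
    cases hc : (q A).2 with
    | true =>
      refine (eq_of_subset_of_card_le (fun x hx => ?_) (by rw [hA'.2, hB'.2])).symm
      simpa [hc, hx] using himp x (hB'.1 hx)
    | false =>
      refine eq_of_subset_of_card_le (fun x hx => ?_) (by rw [hA'.2, hB'.2])
      simpa [hc, hx] using himp x (hA'.1 hx)
  intro A hA B hB hAB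
  rcases le_total (θ A) (θ B) with h | h
  · exact hmono A hA B hB hAB h
  · exact (hmono B hB A hA hAB.symm h).symm

/-- Lower bound: the `ℓ` chains that contain every subset of a `d`-element set up to complement are
realised by `ℓ` features. -/
theorem exists_classShatters {ℓ d : ℕ} (hd : d.choose (d / 2) ≤ 2 * ℓ) :
    ∃ S : Finset (Fin ℓ → ℝ), ClassShatters (stumpClass ℓ) S ∧ #S = d := by
  classical
  obtain ⟨C, hC, hcover⟩ := exists_isChain_cover (α := Fin d) (ℓ := ℓ) (by simpa using hd)
  choose x hx using fun i => exists_superlevel_of_isChain (hC i)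
  let P : Fin d → Fin ℓ → ℝ := fun p i => x i p
  have key : ∀ g : Fin d → Bool, ∃ h ∈ stumpClass ℓ, ∀ p, h (P p) = g p := by
    intro g
    -- The set with label `c` lies in some chain, for one of the two labels `c`.
    obtain ⟨i, c, hc⟩ : ∃ i c, ({p | g p = c} : Finset (Fin d)) ∈ C i := by
      obtain ⟨i, hi | hi⟩ := hcover {p | g p = true}
      · exact ⟨i, true, hi⟩
      · refine ⟨i, false, ?_⟩
        convert hi using 1
        ext p
        simp
    obtain ⟨θ, hθ⟩ := hx i _ hc
    obtain ⟨h, hh, hhx⟩ := exists_mem_stumpClass i θ c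
    refine ⟨h, hh, fun p => ?_⟩
    have h1 : h (P p) = c ↔ g p = c := by
      rw [hhx, ← hθ p]
      simp
    revert h1
    cases h (P p) <;> cases g p <;> cases c <;> simp
  -- The points are distinct because stumps separate them.
  have hP : Function.Injective P := by
    intro p q hpq
    obtain ⟨h, -, hh⟩ := key fun r => decide (r = p)
    have h1 := hh p
    rw [hpq, hh q] at h1
    exact (of_decide_eq_true (h1.trans (decide_eq_true rfl))).symm
  refine ⟨univ.image P, fun g => ?_, by rw [card_image_of_injective _ hP]; simp⟩
  obtain ⟨h, hh, hg⟩ := key fun p => g ⟨P p, mem_image_of_mem P (mem_univ p)⟩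
  refine ⟨h, hh, fun ⟨y, hy⟩ => ?_⟩
  obtain ⟨p, -, rfl⟩ := mem_image.1 hy
  exact hg p

theorem bddAbove_choose_half_le (n : ℕ) : BddAbove {m : ℕ | m.choose (m / 2) ≤ n} := by
  refine ⟨n, fun m hm => ?_⟩
  have := Nat.choose_le_middle 1 m
  rw [Nat.choose_one_right] at this
  exact this.trans hm

end Stump

theorem mainTheorem2 (ℓ : ℕ) (hℓ : 1 ≤ ℓ) :
    ∃ d : ℕ, IsGreatest {m : ℕ | m.choose (m / 2) ≤ 2 * ℓ} d ∧
      classVCDim (stumpClass ℓ) = (d : ℕ∞) := by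
  have hgreatest : IsGreatest {m : ℕ | m.choose (m / 2) ≤ 2 * ℓ} _ :=
    ⟨Nat.sSup_mem ⟨0, show Nat.choose 0 0 ≤ 2 * ℓ by simp; omega⟩ (bddAbove_choose_half_le _),
      fun _ hm => le_csSup (bddAbove_choose_half_le _) hm⟩
  refine ⟨_, hgreatest, le_antisymm ?_ ?_⟩
  · exact iSup₂_le fun S hS => by
      exact_mod_cast hgreatest.2 (choose_le_of_classShatters hℓ hS)
  · obtain ⟨S, hS, hcard⟩ := exists_classShatters hgreatest.1
    rw [← hcard]
    exact le_iSup₂_of_le S hS le_rfl
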